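/- Let $n\in\mathbb N$ and let $F:\mathbb R^n\rightrightarrows\mathbb R^n$ be a multifunction satisfying assumption (F): (F1) $F(x)$ is nonempty, convex and compact for every $x\in\mathbb R^n$; (F2) for every compact $C\subset\mathbb R^n$ there is $L>0$ such that $F(x)\subset F(y)+L|y-x|\,\overline{\mathbb B}$ for all $x,y\in C$, where $\overline{\mathbb B}$ is the closed Euclidean unit ball; (F3) there is $\gamma>0$ such that $|v|\le\gamma(1+|x|)$ for all $x\in\mathbb R^n$ and $v\in F(x)$. Let $\mathcal K\subset\mathbb R^n$ be closed. For $T>0$, a trajectory of $F$ on $[0,T]$ starting at $x$ is an absolutely continuous function $x(\cdot):[0,T]\to\mathbb R^n$ with $x(0)=x$ and $\dot x(t)\in F(x(t))$ for a.e. $t\in[0,T]$. The minimum time function $\mathcal T:\mathbb R^n\to[0,+\infty]$ is given by $\mathcal T(x)=0$ for $x\in\mathcal K$ and, for $x\notin\mathcal K$, $$\mathcal T(x)=\inf\{T>0:\ \text{there is a trajectory } x(\cdot) \text{ of } F \text{ on } [0,T] \text{ with } x(0)=x,\ x(T)\in\mathcal K\},\qquad \inf\emptyset=+\infty.$$ Put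 $\mathcal R(t)=\{y\in\mathbb R^n:\mathcal T(y)\le t\}$, $\mathcal R=\{y\in\mathbb R^n:\mathcal T(y)<+\infty\}$, $\mathrm{epi}(\mathcal T)=\{(y,\beta)\in\mathbb R^n\times\mathbb R:\mathcal T(y)\le\beta\}$, and $h(x,\zeta)=\min_{v\in F(x)}\langle v,\zeta\rangle$ for $x,\zeta\in\mathbb R^n$. For a subset $S$ of a Euclidean space and $z\in S$, the proximal normal cone $N^P_S(z)$ is the set of all vectors $v$ for which there is $\sigma\ge 0$ with $\langle v,y-z\rangle\le\sigma|y-z|^2$ for all $y\in S$. Let $x\in\mathcal R\setminus\mathcal K$. Then: (i) if $\zeta\in N^P_{\mathcal R(\mathcal T(x))}(x)$, then $(\zeta,h(x,\zeta))\in N^P_{\mathrm{epi}(\mathcal T)}(x,\mathcal T(x))$; (ii) if $\zeta\in\mathbb R^n$ and $\alpha\in\mathbb R$ satisfy $(\zeta,\alpha)\in N^P_{\mathrm{epi}(\mathcal T)}(x,\mathcal T(x))$, then $\alpha\le 0$, $\zeta\in N^P_{\mathcal R(\mathcal T(x))}(x)$ and $h(x,\zeta)=\alpha$. -/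

import Mathlib

open MeasureTheory Set
open scoped ENNReal Pointwise

noncomputable section

namespace MinTime

/-- `v` is a proximal normal to `K` at `x` (where `x ∈ K`) if, for some `σ ≥ 0`,
`⟨v, y - x⟩ ≤ σ |y - x|²` for all `y ∈ K`. The proximal normal cone is the set of these `v`. -/
def proximalNormalCone {H : Type*} [NormedAddCommGroup H] [InnerProductSpace ℝ H]
    (K : Set H) (x : H) : Set H :=
  {v | ∃ σ : ℝ, 0 ≤ σ ∧ ∀ y ∈ K, inner ℝ v (y - x) ≤ σ * ‖y - x‖ ^ 2}

/-- The epigraph of an extended-real-valued function, as a subset of the product `H × ℝ` with its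
Euclidean (Hilbert) structure. Points where the function is `⊤` contribute nothing. -/
def epigraph {H : Type*} (f : H → EReal) : Set (WithLp 2 (H × ℝ)) :=
  {p | f p.fst ≤ (p.snd : EReal)}

variable {n : ℕ}

/-- Assumption (F) on a multifunction `F : ℝⁿ ⇉ ℝⁿ`. -/
structure AssumptionF (F : EuclideanSpace ℝ (Fin n) → Set (EuclideanSpace ℝ (Fin n))) : Prop where
  nonempty : ∀ x, (F x).Nonempty
  convex : ∀ x, Convex ℝ (F x)
  compact : ∀ x, IsCompact (F x)
  locallyLipschitz : ∀ C : Set (EuclideanSpace ℝ (Fin n)), IsCompact C → ∃ L : ℝ, 0 < L ∧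
    ∀ x ∈ C, ∀ y ∈ C, F x ⊆ F y + Metric.closedBall 0 (L * ‖y - x‖)
  linearGrowth : ∃ γ : ℝ, 0 < γ ∧ ∀ x, ∀ v ∈ F x, ‖v‖ ≤ γ * (1 + ‖x‖)

/-- `z` restricted to `[0, T]` is a trajectory of `F`: it is absolutely continuous on `[0, T]`, and
for almost every `t ∈ [0, T]` it has a derivative at `t`, which lies in `F (z t)`. -/
def IsTrajectory (F : EuclideanSpace ℝ (Fin n) → Set (EuclideanSpace ℝ (Fin n))) (T : ℝ)
    (z : ℝ → EuclideanSpace ℝ (Fin n)) : Prop :=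
  AbsolutelyContinuousOnInterval z 0 T ∧
    ∀ᵐ t ∂(volume.restrict (Icc (0 : ℝ) T)), ∃ v ∈ F (z t), HasDerivAt z v t

open Classical in
/-- The minimum time function with target `K`: it is `0` on `K`, and outside `K` it is the infimum
of the times `T > 0` at which a trajectory starting at `x` is in `K` (`∞` if there are none). -/
def minTime (F : EuclideanSpace ℝ (Fin n) → Set (EuclideanSpace ℝ (Fin n)))
    (K : Set (EuclideanSpace ℝ (Fin n))) (x : EuclideanSpace ℝ (Fin n)) : ℝ≥0∞ :=
  if x ∈ K then 0
  else sInf {s : ℝ≥0∞ | ∃ T : ℝ, 0 < T ∧ s = ENNReal.ofReal T ∧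
    ∃ z : ℝ → EuclideanSpace ℝ (Fin n), IsTrajectory F T z ∧ z 0 = x ∧ z T ∈ K}

/-- The reachable set at time `t`: the sublevel set `{y | 𝒯(y) ≤ t}`. -/
def reachableAt (F : EuclideanSpace ℝ (Fin n) → Set (EuclideanSpace ℝ (Fin n)))
    (K : Set (EuclideanSpace ℝ (Fin n))) (t : ℝ≥0∞) : Set (EuclideanSpace ℝ (Fin n)) :=
  {y | minTime F K y ≤ t}

/-- The reachable set: the points where the minimum time function is finite. -/
def reachableSet (F : EuclideanSpace ℝ (Fin n) → Set (EuclideanSpace ℝ (Fin n)))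
    (K : Set (EuclideanSpace ℝ (Fin n))) : Set (EuclideanSpace ℝ (Fin n)) :=
  {y | minTime F K y < ∞}

/-- The minimized Hamiltonian `h(x, ζ) = min_{v ∈ F(x)} ⟨v, ζ⟩`; the infimum is a minimum because
`F x` is nonempty and compact under assumption (F). -/
def minHamiltonian (F : EuclideanSpace ℝ (Fin n) → Set (EuclideanSpace ℝ (Fin n)))
    (x ζ : EuclideanSpace ℝ (Fin n)) : ℝ :=
  sInf ((fun v => inner ℝ v ζ) '' F x)

/-- The epigraph of the minimum time function. -/
def epiMinTime (F : EuclideanSpace ℝ (Fin n) → Set (EuclideanSpace ℝ (Fin n)))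
    (K : Set (EuclideanSpace ℝ (Fin n))) : Set (WithLp 2 (EuclideanSpace ℝ (Fin n) × ℝ)) :=
  epigraph (fun y => (minTime F K y : EReal))

end MinTime

end

/-! Put $r=\mathcal T(x)>0$ and $H=h(x,\zeta)$. Both claims rest on moving points of the epigraph
along $F$ with errors quadratic in the distance $d$ to $(x,r)$.

Forward: a nearly optimal trajectory followed for time $t$ lowers $\mathcal T$ by about $t$, and its
displacement has inner product with $\zeta$ at least $tH$ minus a second-order error
(`IsTrajectory.mul_minHamiltonian_le`, `exists_forward_point`). Backward: if $v\in F(x)$ attains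
$H$, a Filippov construction for $-F$ gives a trajectory ending at a prescribed point with mean
velocity nearly $v$ (`exists_isTrajectory_ending_at`); its initial point has $\mathcal T$ larger by
at most the elapsed time (`minTime_le_add`).

For (i), $(y,\beta)$ is carried into $\mathcal R(r)$, backward if $\beta\le r$ and forward if
$\beta>r$ (no motion if $y\in\mathcal K$), and the proximal inequality is applied there; $H\le 0$
controls the signs. For (ii), $\alpha\le 0$ comes from points above $(x,r)$, the claim on $\zeta$
from the slice $\beta=r$, and forward and backward motion from $x$ give $H\le\alpha$ and $\alpha\le
H$. Optimal trajectories are never needed: slack of order $d^2$ or $t^2$ is harmless. -/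

open Filter Topology

/-! ### Absolutely continuous functions -/

namespace AbsolutelyContinuousOnInterval

/-- Monotonicity keeps disjoint intervals disjoint and the Lipschitz bound does not increase total
length, so the same δ works. Applied to time shifts and clamps. -/
lemma comp_monotone {X : Type*} [PseudoMetricSpace X] {f : ℝ → X} {φ : ℝ → ℝ} {a b c d : ℝ}
    (hf : AbsolutelyContinuousOnInterval f a b) (hφ : Monotone φ) (hl : LipschitzWith 1 φ)
    (hm : MapsTo φ (uIcc c d) (uIcc a b)) :
    AbsolutelyContinuousOnInterval (fun t => f (φ t)) c d := by
  rw [absolutelyContinuousOnInterval_iff] at hf ⊢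
  intro ε hε
  obtain ⟨δ, hδ, h⟩ := hf ε hε
  refine ⟨δ, hδ, fun E hE hs => ?_⟩
  refine h (E.1, fun i => (φ (E.2 i).1, φ (E.2 i).2)) ⟨fun i hi => ?_, ?_⟩ ?_
  · exact ⟨hm (hE.1 i hi).1, hm (hE.1 i hi).2⟩
  · intro i hi j hj hij
    have := hE.2 hi hj hij
    simp only [Function.onFun, uIoc, Ioc_disjoint_Ioc] at this ⊢
    simpa only [hφ.map_min, hφ.map_max] using hφ this
  · refine lt_of_le_of_lt (Finset.sum_le_sum fun i _ => ?_) hs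
    simpa using hl.dist_le_mul (E.2 i).1 (E.2 i).2

lemma lipschitz_comp {X Y : Type*} [PseudoMetricSpace X] [PseudoMetricSpace Y] {f : ℝ → X}
    {g : X → Y} {C : NNReal} {a b : ℝ} (hf : AbsolutelyContinuousOnInterval f a b)
    (hg : LipschitzWith C g) : AbsolutelyContinuousOnInterval (fun t => g (f t)) a b := by
  have h := Tendsto.const_mul (C : ℝ) hf
  rw [mul_zero] at h
  refine squeeze_zero (fun E => Finset.sum_nonneg fun i _ => dist_nonneg) (fun E => ?_) h
  rw [Finset.mul_sum]
  exact Finset.sum_le_sum fun i _ => hg.dist_le_mul _ _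

lemma mul_le_sub_of_ae_le_deriv {f : ℝ → ℝ} {c t : ℝ} (ht : 0 ≤ t)
    (hf : AbsolutelyContinuousOnInterval f 0 t)
    (h : ∀ᵐ s, s ∈ Icc 0 t → ∃ d, c ≤ d ∧ HasDerivAt f d s) : t * c ≤ f t - f 0 := by
  rw [← hf.integral_deriv_eq_sub]
  have h1 : ∫ _ in (0 : ℝ)..t, c = t * c := by simp
  rw [← h1]
  refine intervalIntegral.integral_mono_ae_restrict ht (by simp) hf.intervalIntegrable_deriv ?_
  rw [EventuallyLE, ae_restrict_iff' measurableSet_Icc]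
  filter_upwards [h] with s hs hst
  obtain ⟨d, hd, h'⟩ := hs hst
  rwa [h'.deriv]

end AbsolutelyContinuousOnInterval

/-! ### Trajectories and dynamic programming -/

namespace MinTime

variable {n : ℕ} {F : EuclideanSpace ℝ (Fin n) → Set (EuclideanSpace ℝ (Fin n))}
  {K : Set (EuclideanSpace ℝ (Fin n))}

lemma IsTrajectory.ae {T : ℝ} {z : ℝ → EuclideanSpace ℝ (Fin n)} (h : IsTrajectory F T z) :
    ∀ᵐ t, t ∈ Icc 0 T → ∃ v ∈ F (z t), HasDerivAt z v t :=
  (ae_restrict_iff' measurableSet_Icc).1 h.2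

lemma IsTrajectory.of_ae {T : ℝ} {z : ℝ → EuclideanSpace ℝ (Fin n)}
    (hz : AbsolutelyContinuousOnInterval z 0 T)
    (h : ∀ᵐ t, t ∈ Icc 0 T → ∃ v ∈ F (z t), HasDerivAt z v t) : IsTrajectory F T z :=
  ⟨hz, (ae_restrict_iff' measurableSet_Icc).2 h⟩

lemma IsTrajectory.shift {T t : ℝ} {z : ℝ → EuclideanSpace ℝ (Fin n)} (h : IsTrajectory F T z)
    (ht : 0 ≤ t) (htT : t ≤ T) : IsTrajectory F (T - t) (fun s => z (t + s)) := by
  refine .of_ae ?_ ?_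
  · refine h.1.comp_monotone (fun a b hab => by simpa using hab)
      (LipschitzWith.of_dist_le_mul fun a b => by simp) ?_
    rw [uIcc_of_le (by linarith), uIcc_of_le (by linarith)]
    intro s hs
    constructor <;> linarith [hs.1, hs.2]
  · have := (measurePreserving_add_left (volume : Measure ℝ) t).quasiMeasurePreserving.ae h.ae
    filter_upwards [this] with s hs hst
    obtain ⟨v, hv, hd⟩ := hs ⟨by linarith [hst.1], by linarith [hst.2]⟩
    exact ⟨v, hv, hd.comp_const_add t s⟩

lemma IsTrajectory.trans {τ T : ℝ} {w z : ℝ → EuclideanSpace ℝ (Fin n)} (hτ : 0 ≤ τ) (hT : 0 ≤ T)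
    (hw : IsTrajectory F τ w) (hz : IsTrajectory F T z) (hwz : w τ = z 0) :
    IsTrajectory F (τ + T) (fun s => if s ≤ τ then w s else z (s - τ)) := by
  refine .of_ae ?_ ?_
  -- On `[0, τ + T]` the concatenation equals `w` with clamped time plus `z` with clamped time minus
  -- the junction value, which avoids gluing at `τ`.
  · have h1 : AbsolutelyContinuousOnInterval (fun s => w (min (max s 0) τ)) 0 (τ + T) := by
      refine hw.1.comp_monotone ?_ ?_ ?_
      · intro a b hab
        exact min_le_min (max_le_max hab le_rfl) le_rfl
      · exact (LipschitzWith.id.max_const 0).min_const τ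
      · rw [uIcc_of_le hτ]
        intro s _
        exact ⟨le_min (le_max_right _ _) hτ, min_le_right _ _⟩
    have h2 : AbsolutelyContinuousOnInterval (fun s => z (max (s - τ) 0)) 0 (τ + T) := by
      refine hz.1.comp_monotone ?_ ?_ ?_
      · intro a b hab
        exact max_le_max (by linarith) le_rfl
      · exact LipschitzWith.max_const (LipschitzWith.of_dist_le_mul fun a b => by simp) 0
      · rw [uIcc_of_le hT, uIcc_of_le (by linarith)]
        intro s hs
        exact ⟨le_max_right _ _, max_le (by linarith [hs.2]) hT⟩
    have h3 : AbsolutelyContinuousOnInterval (fun _ : ℝ => z 0) 0 (τ + T) :=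
      LipschitzOnWith.absolutelyContinuousOnInterval (K := 0)
        (LipschitzWith.const (z 0)).lipschitzOnWith
    have h4 := (h1.add h2).sub h3
    rw [absolutelyContinuousOnInterval_iff] at h4 ⊢
    intro ε hε
    obtain ⟨δ, hδ, h⟩ := h4 ε hε
    refine ⟨δ, hδ, fun E hE hs => ?_⟩
    have key : ∀ s ∈ uIcc 0 (τ + T), (if s ≤ τ then w s else z (s - τ)) =
        w (min (max s 0) τ) + z (max (s - τ) 0) - z 0 := by
      rw [uIcc_of_le (by linarith)]
      intro s hs
      split_ifs with hsτ
      · rw [max_eq_left hs.1, min_eq_left hsτ, max_eq_right (by linarith)]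
        simp
      · push Not at hsτ
        rw [max_eq_left hs.1, min_eq_right hsτ.le, max_eq_left (by linarith), hwz]
        abel
    have := h E hE hs
    refine lt_of_le_of_lt (Finset.sum_le_sum fun i hi => le_of_eq ?_) this
    rw [key _ (hE.1 i hi).1, key _ (hE.1 i hi).2]
    rfl
  · have h2 := (measurePreserving_add_right (volume : Measure ℝ) (-τ)).quasiMeasurePreserving.ae
      hz.ae
    have h3 : ∀ᵐ s : ℝ, s ≠ τ := by simp [ae_iff, measure_singleton]
    filter_upwards [hw.ae, h2, h3] with s hs1 hs2 hs3 hs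
    rcases lt_or_gt_of_ne hs3 with hlt | hgt
    · obtain ⟨v, hv, hd⟩ := hs1 ⟨hs.1, hlt.le⟩
      refine ⟨v, by simpa [hlt.le] using hv, hd.congr_of_eventuallyEq ?_⟩
      filter_upwards [Iio_mem_nhds hlt] with r hr
      simp [(show r < τ from hr).le]
    · obtain ⟨v, hv, hd⟩ := hs2 ⟨by linarith, by linarith [hs.2]⟩
      refine ⟨v, by simpa [hgt.not_ge, sub_eq_add_neg] using hv, ?_⟩
      refine (hd.comp_add_const s (-τ)).congr_of_eventuallyEq ?_
      filter_upwards [Ioi_mem_nhds hgt] with r hr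
      simp [not_le.2 (show τ < r from hr), sub_eq_add_neg]

lemma minTime_of_mem {y : EuclideanSpace ℝ (Fin n)} (hy : y ∈ K) : minTime F K y = 0 := by
  simp [minTime, hy]

lemma minTime_le_of_isTrajectory {T : ℝ} {z : ℝ → EuclideanSpace ℝ (Fin n)} (hT : 0 ≤ T)
    (hz : IsTrajectory F T z) (hzT : z T ∈ K) : minTime F K (z 0) ≤ ENNReal.ofReal T := by
  by_cases h0 : z 0 ∈ K
  · simp [minTime_of_mem h0]
  have hT' : 0 < T := by
    rcases hT.eq_or_lt with rfl | h
    · exact absurd hzT h0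
    · exact h
  rw [minTime, if_neg h0]
  exact sInf_le ⟨T, hT', rfl, z, hz, rfl, hzT⟩

lemma minTime_isTrajectory_le {T t : ℝ} {z : ℝ → EuclideanSpace ℝ (Fin n)}
    (hz : IsTrajectory F T z) (hzT : z T ∈ K) (ht : 0 ≤ t) (htT : t ≤ T) :
    minTime F K (z t) ≤ ENNReal.ofReal (T - t) := by
  have := minTime_le_of_isTrajectory (K := K) (sub_nonneg.2 htT) (hz.shift ht htT)
    (by simpa using hzT)
  simpa using this

lemma exists_isTrajectory_of_minTime_lt {y : EuclideanSpace ℝ (Fin n)} {b : ℝ} (hy : y ∉ K)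
    (h : minTime F K y < ENNReal.ofReal b) :
    ∃ T, 0 < T ∧ T < b ∧ minTime F K y ≤ ENNReal.ofReal T ∧
      ∃ z, IsTrajectory F T z ∧ z 0 = y ∧ z T ∈ K := by
  have h' := h
  rw [minTime, if_neg hy, sInf_lt_iff] at h'
  obtain ⟨s, ⟨T, hT, rfl, z, hz, hz0, hzT⟩, hs⟩ := h'
  refine ⟨T, hT, (ENNReal.ofReal_lt_ofReal_iff_of_nonneg hT.le).1 hs, ?_, z, hz, hz0, hzT⟩
  rw [← hz0]
  exact minTime_le_of_isTrajectory hT.le hz hzT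

/-- Dynamic programming: prepend `w` to any trajectory from `w τ` to the target, then take the
infimum. -/
lemma minTime_le_add {τ : ℝ} {w : ℝ → EuclideanSpace ℝ (Fin n)} (hτ : 0 ≤ τ)
    (hw : IsTrajectory F τ w) : minTime F K (w 0) ≤ ENNReal.ofReal τ + minTime F K (w τ) := by
  by_cases hK : w τ ∈ K
  · exact (minTime_le_of_isTrajectory hτ hw hK).trans le_self_add
  conv_rhs => rw [minTime, if_neg hK]
  rw [ENNReal.add_sInf]
  refine le_iInf₂ ?_
  rintro _ ⟨T, hT, rfl, z, hz, hz0, hzT⟩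
  have := minTime_le_of_isTrajectory (K := K) (by positivity) (hw.trans hτ hT.le hz hz0.symm)
    (by rw [if_neg (by linarith)]; simpa using hzT)
  rw [← ENNReal.ofReal_add hτ hT.le]
  simpa [hτ] using this

end MinTime

/-! ### Nearest points of convex sets -/

lemma exists_dist_le_of_subset_add_closedBall {E : Type*} [NormedAddCommGroup E] {S S' : Set E} {r : ℝ}
    (h : S ⊆ S' + Metric.closedBall 0 r) {p : E} (hp : p ∈ S) : ∃ q ∈ S', dist q p ≤ r := by
  obtain ⟨q, hq, b, hb, rfl⟩ := h hp
  exact ⟨q, hq, by simpa using hb⟩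

section Projection

variable {E : Type*} [NormedAddCommGroup E] [InnerProductSpace ℝ E]

/-- Hölder estimate for nearest points of two convex sets. -/
lemma Convex.dist_nearest_point_le {S S' : Set E} (hS : Convex ℝ S) {w w' p p' q q' : E} {η : ℝ}
    (hp : p ∈ S) (hwp : Metric.infDist w S = dist w p)
    (hwp' : Metric.infDist w' S' = dist w' p')
    (hq : q ∈ S) (hqp' : dist q p' ≤ η) (hq' : q' ∈ S') (hqp : dist q' p ≤ η) :
    dist p p' ≤ η + √(4 * dist w p * (2 * (η + dist w w')) + 2 * (2 * (η + dist w w')) ^ 2) := by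
  have hη : 0 ≤ η := dist_nonneg.trans hqp
  set e := 2 * (η + dist w w') with he
  have he0 : 0 ≤ e := by positivity
  have h1 : dist w' p' ≤ dist w p + dist w w' + η := by
    have a1 := Metric.infDist_le_dist_of_mem (x := w') hq'
    have a2 := dist_triangle4 w' w p q'
    rw [dist_comm w' w, dist_comm p q'] at a2
    linarith
  have h2 : dist w q ≤ dist w p + e := by
    have a2 := dist_triangle4 w w' p' q
    rw [dist_comm p' q] at a2
    linarith
  have h3 : dist w p ≤ dist w (midpoint ℝ p q) := by
    rw [← hwp]
    exact Metric.infDist_le_dist_of_mem (hS.midpoint_mem hp hq)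
  -- `q` is within `e` of being a nearest point of `S`, and the midpoint of `p` and `q` is no closer
  -- to `w` than `p`; the parallelogram law then bounds `dist p q`.
  have h4 : dist p q ≤ √(4 * dist w p * e + 2 * e ^ 2) := by
    apply Real.le_sqrt_of_sq_le
    have par := parallelogram_law_with_norm ℝ (w - p) (w - q)
    have e1 : w - p + (w - q) = (2 : ℝ) • (w - midpoint ℝ p q) := by
      rw [midpoint_eq_smul_add, smul_sub, smul_smul]
      norm_num [two_smul]
      abel
    have e2 : w - p - (w - q) = q - p := by abel
    rw [e1, e2, norm_smul, ← dist_eq_norm, ← dist_eq_norm, ← dist_eq_norm, ← dist_eq_norm,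
      dist_comm q p] at par
    norm_num at par
    have := dist_nonneg (x := w) (y := p)
    have := dist_nonneg (x := w) (y := q)
    nlinarith
  linarith [dist_triangle p q p']

end Projection

/-! ### Filippov's theorem with continuous velocities -/

section Filippov

variable {E : Type*} [NormedAddCommGroup E] [InnerProductSpace ℝ E]
  {G : E → Set E} {B : Set E} {L M : ℝ}

/-- Nearest-point selections along continuous curves are continuous. -/
lemma exists_continuous_nearest_selection (hne : ∀ a, (G a).Nonempty) (hcv : ∀ a, Convex ℝ (G a))
    (hcp : ∀ a, IsCompact (G a))
    (hL : ∀ a ∈ B, ∀ b ∈ B, G a ⊆ G b + Metric.closedBall 0 (L * ‖b - a‖))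
    {f a : ℝ → E} (hf : Continuous f) (ha : Continuous a) (haB : ∀ t, a t ∈ B) :
    ∃ g : ℝ → E, Continuous g ∧ ∀ t, g t ∈ G (a t) ∧
      Metric.infDist (f t) (G (a t)) = dist (f t) (g t) := by
  choose g hg hd using fun t => (hcp (a t)).exists_infDist_eq_dist (hne (a t)) (f t)
  refine ⟨g, ?_, fun t => ⟨hg t, hd t⟩⟩
  rw [continuous_iff_continuousAt]
  intro t₀
  rw [ContinuousAt, tendsto_iff_dist_tendsto_zero]
  have key : ∀ t, dist (g t) (g t₀) ≤ L * ‖a t₀ - a t‖ +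
      √(4 * dist (f t₀) (g t₀) * (2 * (L * ‖a t₀ - a t‖ + dist (f t₀) (f t))) +
        2 * (2 * (L * ‖a t₀ - a t‖ + dist (f t₀) (f t))) ^ 2) := by
    intro t
    obtain ⟨q, hq, hqd⟩ := exists_dist_le_of_subset_add_closedBall
      (hL _ (haB t) _ (haB t₀)) (hg t)
    obtain ⟨q', hq', hqd'⟩ := exists_dist_le_of_subset_add_closedBall
      (hL _ (haB t₀) _ (haB t)) (hg t₀)
    rw [norm_sub_rev] at hqd'
    rw [dist_comm]
    exact (hcv (a t₀)).dist_nearest_point_le (hg t₀) (hd t₀) (hd t) hq hqd hq' hqd'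
  refine squeeze_zero (fun t => dist_nonneg) key ?_
  have hc : Continuous fun t => L * ‖a t₀ - a t‖ +
      √(4 * dist (f t₀) (g t₀) * (2 * (L * ‖a t₀ - a t‖ + dist (f t₀) (f t))) +
        2 * (2 * (L * ‖a t₀ - a t‖ + dist (f t₀) (f t))) ^ 2) := by fun_prop
  simpa using hc.tendsto t₀

/-- A `C¹` version of Filippov's theorem: a constant velocity `v ∈ G x` can be corrected to the
continuous velocity of a solution of `ẏ ∈ G y` starting near `x`. -/
theorem exists_continuous_velocity [CompleteSpace E] (hne : ∀ a, (G a).Nonempty)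
    (hcv : ∀ a, Convex ℝ (G a)) (hcp : ∀ a, IsCompact (G a)) {x y v : E} {ρ τ : ℝ} (hρ : 0 ≤ ρ) (hL0 : 0 ≤ L)
    (hL : ∀ a ∈ Metric.closedBall x ρ, ∀ b ∈ Metric.closedBall x ρ,
      G a ⊆ G b + Metric.closedBall 0 (L * ‖b - a‖))
    (hM : ∀ a ∈ Metric.closedBall x ρ, ∀ w ∈ G a, ‖w‖ ≤ M) (hv : v ∈ G x) (hτ : 0 ≤ τ)
    (hLτ : L * τ ≤ 1 / 2) (hyρ : ‖y - x‖ + M * τ ≤ ρ) :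
    ∃ f : ℝ → E, Continuous f ∧ (∀ t, ‖f t‖ ≤ M) ∧
      (∀ t ∈ Icc 0 τ, f t ∈ G (y + ∫ s in (0 : ℝ)..t, f s)) ∧
      ∀ t, ‖f t - v‖ ≤ 2 * (L * (‖y - x‖ + M * τ)) := by
  have hx : x ∈ Metric.closedBall x ρ := Metric.mem_closedBall_self hρ
  have hM0 : 0 ≤ M := (norm_nonneg v).trans (hM x hx v hv)
  -- Clamping time to `[0, τ]` keeps every curve `P f` in the ball for all real `t`, so bounds hold
  -- globally.
  set c : ℝ → ℝ := fun t => max 0 (min t τ) with hc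
  have hcc : Continuous c := by fun_prop
  have hc0 : ∀ t, 0 ≤ c t := fun t => le_max_left _ _
  have hcτ : ∀ t, c t ≤ τ := fun t => max_le hτ (min_le_right _ _)
  set P : (ℝ → E) → ℝ → E := fun f t => y + ∫ s in (0 : ℝ)..c t, f s with hP
  have hPc : ∀ f, Continuous f → Continuous (P f) := fun f hf =>
    continuous_const.add ((intervalIntegral.continuous_primitive
      (fun a b => hf.intervalIntegrable a b) 0).comp hcc)
  have hPB : ∀ f : ℝ → E, (∀ t, ‖f t‖ ≤ M) → ∀ t, ‖P f t - x‖ ≤ ‖y - x‖ + M * τ := by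
    intro f hf t
    have h1 : ‖∫ s in (0 : ℝ)..c t, f s‖ ≤ M * |c t - 0| :=
      intervalIntegral.norm_integral_le_of_norm_le_const fun s _ => hf s
    rw [sub_zero, abs_of_nonneg (hc0 t)] at h1
    have h2 : P f t - x = (y - x) + ∫ s in (0 : ℝ)..c t, f s := by simp only [hP]; abel
    rw [h2]
    refine (norm_add_le _ _).trans ?_
    nlinarith [hcτ t]
  have hPd : ∀ f g : ℝ → E, Continuous f → Continuous g → ∀ D, (∀ t, dist (f t) (g t) ≤ D) →
      ∀ t, ‖P f t - P g t‖ ≤ D * τ := by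
    intro f g hf hg D hD t
    have h2 : P f t - P g t = ∫ s in (0 : ℝ)..c t, (f s - g s) := by
      rw [intervalIntegral.integral_sub (hf.intervalIntegrable _ _) (hg.intervalIntegrable _ _)]
      simp only [hP]; abel
    have h1 : ‖∫ s in (0 : ℝ)..c t, (f s - g s)‖ ≤ D * |c t - 0| :=
      intervalIntegral.norm_integral_le_of_norm_le_const fun s _ => by
        rw [← dist_eq_norm]; exact hD s
    rw [sub_zero, abs_of_nonneg (hc0 t)] at h1
    rw [h2]
    exact h1.trans (mul_le_mul_of_nonneg_left (hcτ t) (dist_nonneg.trans (hD 0)))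
  have hPmem : ∀ f : ℝ → E, (∀ t, ‖f t‖ ≤ M) → ∀ t, P f t ∈ Metric.closedBall x ρ := by
    intro f hf t
    rw [mem_closedBall_iff_norm]
    exact (hPB f hf t).trans hyρ
  have hstep : ∀ f : {f : ℝ → E // Continuous f ∧ ∀ t, ‖f t‖ ≤ M},
      ∃ g : {f : ℝ → E // Continuous f ∧ ∀ t, ‖f t‖ ≤ M}, ∀ t, g.1 t ∈ G (P f.1 t) ∧
        Metric.infDist (f.1 t) (G (P f.1 t)) = dist (f.1 t) (g.1 t) := by
    rintro ⟨f, hf, hfM⟩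
    obtain ⟨g, hg, hgt⟩ := exists_continuous_nearest_selection hne hcv hcp hL hf (hPc f hf)
      (hPmem f hfM)
    exact ⟨⟨g, hg, fun t => hM _ (hPmem f hfM t) _ (hgt t).1⟩, hgt⟩
  choose step hs using hstep
  -- Picard iteration on velocities: start from the constant `v` and project each velocity onto `G`
  -- along the curve it generates. Since `L * τ ≤ 1 / 2`, each correction is at most half the bound
  -- on the previous one.
  let u : ℕ → {f : ℝ → E // Continuous f ∧ ∀ t, ‖f t‖ ≤ M} := fun k =>
    step^[k] ⟨fun _ => v, continuous_const, fun _ => hM x hx v hv⟩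
  have hu : ∀ k, u (k + 1) = step (u k) := fun k => Function.iterate_succ_apply' _ _ _
  set A := L * (‖y - x‖ + M * τ) with hA
  have hmove : ∀ (k : ℕ) (t : ℝ) (a p : E), a ∈ Metric.closedBall x ρ → p ∈ G a →
      p = (u k).1 t → dist ((u k).1 t) ((u (k + 1)).1 t) ≤ L * ‖P (u k).1 t - a‖ := by
    intro k t a p ha hp hpu
    obtain ⟨q, hq, hqd⟩ := exists_dist_le_of_subset_add_closedBall
      (hL a ha _ (hPmem (u k).1 (u k).2.2 t)) hp
    rw [hu, ← (hs (u k) t).2, ← hpu]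
    refine (Metric.infDist_le_dist_of_mem hq).trans ?_
    rwa [dist_comm]
  -- The bound is `A / 2 ^ k`, written in the shape of the `geometric_two` lemmas; the sum `2 * A`
  -- is the final distance to `v`.
  have hdist : ∀ k t, dist ((u k).1 t) ((u (k + 1)).1 t) ≤ 2 * A / 2 / 2 ^ k := by
    intro k
    induction k with
    | zero =>
      intro t
      refine (hmove 0 t x v hx hv rfl).trans ?_
      have := mul_le_mul_of_nonneg_left (hPB _ (u 0).2.2 t) hL0
      simpa using this
    | succ k ih =>
      intro t
      refine (hmove (k + 1) t (P (u k).1 t) _ (hPmem _ (u k).2.2 t) ?_ rfl).trans ?_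
      · rw [hu]
        exact (hs (u k) t).1
      · have h1 := hPd (u (k + 1)).1 (u k).1 (u (k + 1)).2.1 (u k).2.1 _
          (fun t => by rw [dist_comm]; exact ih t) t
        have h2 := mul_le_mul_of_nonneg_left h1 hL0
        have h3 : 0 ≤ 2 * A / 2 / 2 ^ k := dist_nonneg.trans (ih 0)
        have h4 : 2 * A / 2 / 2 ^ (k + 1) = 2 * A / 2 / 2 ^ k * (1 / 2) := by
          rw [pow_succ]; field_simp
        rw [h4]
        nlinarith
  choose f hf using fun t => cauchySeq_tendsto_of_complete
    (cauchySeq_of_le_geometric_two fun k => hdist k t)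
  have hunif : TendstoUniformly (fun k => (u k).1) f atTop := by
    rw [Metric.tendstoUniformly_iff]
    intro ε hε
    have h0 : Tendsto (fun k : ℕ => 2 * A / 2 ^ k) atTop (𝓝 0) := by
      have := (tendsto_pow_atTop_nhds_zero_of_lt_one (r := (1 / 2 : ℝ)) (by norm_num)
        (by norm_num)).const_mul (2 * A)
      simpa [div_eq_mul_inv] using this
    filter_upwards [h0.eventually_lt_const hε] with k hk t
    rw [dist_comm]
    exact (dist_le_of_le_geometric_two_of_tendsto (fun k => hdist k t) (hf t) k).trans_lt hk
  have hfc : Continuous f := hunif.continuous (Frequently.of_forall fun k => (u k).2.1)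
  have hfM : ∀ t, ‖f t‖ ≤ M := fun t =>
    le_of_tendsto (hf t).norm (Eventually.of_forall fun k => (u k).2.2 t)
  refine ⟨f, hfc, hfM, ?_, fun t => ?_⟩
  · intro t ht
    have hct : c t = t := by simp [hc, min_eq_left ht.2, max_eq_right ht.1]
    have hPf : y + ∫ s in (0 : ℝ)..t, f s = P f t := by simp [hP, hct]
    rw [hPf, (hcp _).isClosed.mem_iff_infDist_zero (hne _)]
    refine le_antisymm ?_ Metric.infDist_nonneg
    -- Compare `f t` with `u (k + 1)` at `t`, which lies in `G` at a point close to `P f t`.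
    have hb : ∀ k, Metric.infDist (f t) (G (P f t)) ≤
        2 * A / 2 ^ (k + 1) + L * (2 * A / 2 ^ k * τ) := by
      intro k
      have hd : ∀ k t, dist ((u k).1 t) (f t) ≤ 2 * A / 2 ^ k := fun k t =>
        dist_le_of_le_geometric_two_of_tendsto (fun k => hdist k t) (hf t) k
      have hg : (u (k + 1)).1 t ∈ G (P (u k).1 t) := by
        rw [hu]
        exact (hs (u k) t).1
      obtain ⟨q, hq, hqd⟩ := exists_dist_le_of_subset_add_closedBall
        (hL _ (hPmem _ (u k).2.2 t) _ (hPmem f hfM t)) hg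
      have h1 := hPd f (u k).1 hfc (u k).2.1 _ (fun t => by rw [dist_comm]; exact hd k t) t
      have h2 := mul_le_mul_of_nonneg_left h1 hL0
      have h3 := Metric.infDist_le_dist_of_mem (x := f t) hq
      have h4 := dist_triangle (f t) ((u (k + 1)).1 t) q
      linarith [hd (k + 1) t, dist_comm (f t) ((u (k + 1)).1 t),
        dist_comm q ((u (k + 1)).1 t)]
    refine ge_of_tendsto (x := atTop) ?_ (Eventually.of_forall hb)
    have h0 : Tendsto (fun k : ℕ => 2 * A / 2 ^ k) atTop (𝓝 0) := by
      have := (tendsto_pow_atTop_nhds_zero_of_lt_one (r := (1 / 2 : ℝ)) (by norm_num)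
        (by norm_num)).const_mul (2 * A)
      simpa [div_eq_mul_inv] using this
    have h1 := h0.comp (tendsto_add_atTop_nat 1)
    simpa using h1.add ((h0.mul_const τ).const_mul L)
  · have := dist_le_of_le_geometric_two_of_tendsto₀ (fun k => hdist k t) (hf t)
    rw [dist_comm, dist_eq_norm] at this
    exact this

end Filippov

/-! ### Local estimates along trajectories -/

namespace MinTime

variable {n : ℕ} {F : EuclideanSpace ℝ (Fin n) → Set (EuclideanSpace ℝ (Fin n))}
  {K : Set (EuclideanSpace ℝ (Fin n))}

lemma IsTrajectory.mono {T t : ℝ} {z : ℝ → EuclideanSpace ℝ (Fin n)} (h : IsTrajectory F T z)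
    (ht : 0 ≤ t) (htT : t ≤ T) : IsTrajectory F t z := by
  refine .of_ae (h.1.mono ?_) ?_
  · rw [uIcc_of_le ht, uIcc_of_le (ht.trans htT)]
    exact Icc_subset_Icc_right htT
  · filter_upwards [h.ae] with s hs hst
    exact hs ⟨hst.1, hst.2.trans htT⟩

lemma IsTrajectory.mul_le_inner_sub {T c : ℝ} {z : ℝ → EuclideanSpace ℝ (Fin n)}
    (h : IsTrajectory F T z) (hT : 0 ≤ T) (e : EuclideanSpace ℝ (Fin n))
    (hc : ∀ s ∈ Ico 0 T, ∀ w ∈ F (z s), c ≤ inner ℝ w e) : T * c ≤ inner ℝ (z T - z 0) e := by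
  have hac : AbsolutelyContinuousOnInterval (fun s => (innerSL ℝ e) (z s)) 0 T :=
    h.1.lipschitz_comp (innerSL ℝ e).lipschitz
  -- Discarding the endpoint lets the hypothesis be required on `Ico` only, as the first-exit
  -- argument of `norm_sub_le` needs.
  have hne : ∀ᵐ s : ℝ, s ≠ T := by simp [ae_iff, measure_singleton]
  have := hac.mul_le_sub_of_ae_le_deriv (c := c) hT ?_
  · simpa [inner_sub_left, real_inner_comm] using this
  · filter_upwards [h.ae, hne] with s hs hsT hst
    obtain ⟨w, hw, hd⟩ := hs hst
    refine ⟨inner ℝ e w, ?_, ?_⟩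
    · rw [real_inner_comm]
      exact hc s ⟨hst.1, lt_of_le_of_ne hst.2 hsT⟩ w hw
    · exact (innerSL ℝ e).hasFDerivAt.comp_hasDerivAt s hd

section Local

variable {x : EuclideanSpace ℝ (Fin n)} {ρ L M : ℝ}

lemma IsTrajectory.norm_sub_le {T : ℝ} {z : ℝ → EuclideanSpace ℝ (Fin n)}
    (h : IsTrajectory F T z) (hT : 0 ≤ T) (hM0 : 0 ≤ M)
    (hM : ∀ a ∈ Metric.closedBall x ρ, ∀ w ∈ F a, ‖w‖ ≤ M) (hρ : ‖z 0 - x‖ + M * T < ρ) :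
    (∀ t ∈ Icc 0 T, z t ∈ Metric.closedBall x ρ) ∧ ∀ t ∈ Icc 0 T, ‖z t - z 0‖ ≤ M * t := by
  have step : ∀ t ∈ Icc 0 T, (∀ s ∈ Ico 0 t, z s ∈ Metric.closedBall x ρ) →
      ‖z t - z 0‖ ≤ M * t := by
    intro t ht hs
    have h1 := (h.mono ht.1 ht.2).mul_le_inner_sub (c := -(M * ‖z t - z 0‖)) ht.1
      (-(z t - z 0)) ?_
    · rw [inner_neg_right, real_inner_self_eq_norm_sq] at h1
      by_contra hlt
      push Not at hlt
      have := mul_nonneg hM0 ht.1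
      nlinarith
    · intro s hst w hw
      have h2 := abs_real_inner_le_norm w (-(z t - z 0))
      rw [norm_neg] at h2
      have h3 := mul_le_mul_of_nonneg_right (hM _ (hs s hst) w hw) (norm_nonneg (z t - z 0))
      linarith [neg_abs_le (inner ℝ w (-(z t - z 0)))]
  have hball : ∀ t ∈ Icc 0 T, z t ∈ Metric.closedBall x ρ := by
    have hzc : ContinuousOn z (Icc 0 T) := by
      have := h.1.continuousOn
      rwa [uIcc_of_le hT] at this
    by_contra! hcon
    obtain ⟨t₁, ht₁, hb⟩ := hcon
    rw [mem_closedBall_iff_norm, not_le] at hb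
    have hcomp : IsCompact (Icc 0 T ∩ (fun t => ‖z t - x‖) ⁻¹' Ici ρ) :=
      isCompact_Icc.of_isClosed_subset
        ((hzc.sub continuousOn_const).norm.preimage_isClosed_of_isClosed isClosed_Icc isClosed_Ici)
        inter_subset_left
    -- Up to the first time at distance at least `ρ` the speed bound applies, and it forces the
    -- distance below `ρ`.
    obtain ⟨t₀, ht₀, hmin⟩ := hcomp.exists_isLeast ⟨t₁, ht₁, hb.le⟩
    have h1 := step t₀ ht₀.1 fun s hs => by
      rw [mem_closedBall_iff_norm]
      by_contra hcon
      push Not at hcon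
      exact (hmin ⟨⟨hs.1, hs.2.le.trans ht₀.1.2⟩, hcon.le⟩).not_gt hs.2
    have h2 : ρ ≤ ‖z t₀ - x‖ := ht₀.2
    have h3 := norm_add_le (z t₀ - z 0) (z 0 - x)
    rw [sub_add_sub_cancel] at h3
    have := mul_le_mul_of_nonneg_left ht₀.1.2 hM0
    linarith
  exact ⟨hball, fun t ht => step t ht fun s hs => hball s ⟨hs.1, hs.2.le.trans ht.2⟩⟩

lemma minHamiltonian_le (hF : AssumptionF F) {w : EuclideanSpace ℝ (Fin n)} (hw : w ∈ F x)
    (ζ : EuclideanSpace ℝ (Fin n)) : minHamiltonian F x ζ ≤ inner ℝ w ζ :=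
  csInf_le ((hF.compact x).image (by fun_prop)).bddBelow ⟨w, hw, rfl⟩

lemma exists_minHamiltonian_eq (hF : AssumptionF F) (x ζ : EuclideanSpace ℝ (Fin n)) :
    ∃ v ∈ F x, inner ℝ v ζ = minHamiltonian F x ζ :=
  ((hF.compact x).image (f := fun v => inner ℝ v ζ) (by fun_prop)).sInf_mem
    ((hF.nonempty x).image _)

lemma minHamiltonian_sub_le (hF : AssumptionF F) {a w : EuclideanSpace ℝ (Fin n)} {r : ℝ}
    (h : F a ⊆ F x + Metric.closedBall 0 r) (hw : w ∈ F a) (ζ : EuclideanSpace ℝ (Fin n)) :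
    minHamiltonian F x ζ - ‖ζ‖ * r ≤ inner ℝ w ζ := by
  obtain ⟨q, hq, hqw⟩ := exists_dist_le_of_subset_add_closedBall h hw
  have h1 := minHamiltonian_le hF hq ζ
  have h2 := real_inner_le_norm (q - w) ζ
  rw [inner_sub_left] at h2
  rw [dist_eq_norm] at hqw
  have h3 := mul_le_mul_of_nonneg_right hqw (norm_nonneg ζ)
  linarith

lemma IsTrajectory.mul_minHamiltonian_le (hF : AssumptionF F) {T : ℝ}
    {z : ℝ → EuclideanSpace ℝ (Fin n)} (h : IsTrajectory F T z) (hT : 0 ≤ T) (hM0 : 0 ≤ M)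
    (hL0 : 0 ≤ L) (hM : ∀ a ∈ Metric.closedBall x ρ, ∀ w ∈ F a, ‖w‖ ≤ M)
    (hL : ∀ a ∈ Metric.closedBall x ρ, ∀ b ∈ Metric.closedBall x ρ,
      F a ⊆ F b + Metric.closedBall 0 (L * ‖b - a‖))
    (hρ : ‖z 0 - x‖ + M * T < ρ) (ζ : EuclideanSpace ℝ (Fin n)) :
    T * (minHamiltonian F x ζ - ‖ζ‖ * (L * (‖z 0 - x‖ + M * T))) ≤ inner ℝ (z T - z 0) ζ := by
  obtain ⟨hb, hn⟩ := h.norm_sub_le hT hM0 hM hρ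
  have hx : x ∈ Metric.closedBall x ρ := Metric.mem_closedBall_self (by
    have := norm_nonneg (z 0 - x)
    nlinarith)
  refine h.mul_le_inner_sub hT ζ fun s hs w hw => ?_
  have hs' : s ∈ Icc 0 T := ⟨hs.1, hs.2.le⟩
  refine le_trans ?_ (minHamiltonian_sub_le hF (hL _ (hb s hs') x hx) hw ζ)
  have h3 := norm_add_le (z s - z 0) (z 0 - x)
  rw [sub_add_sub_cancel, norm_sub_rev] at h3
  have h4 := mul_le_mul_of_nonneg_left hs.2.le hM0
  have h5 : ‖x - z s‖ ≤ ‖z 0 - x‖ + M * T := by linarith [hn s hs']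
  gcongr

/-- A trajectory arriving at `y` at time `τ` whose mean velocity is nearly `v ∈ F x`. -/
lemma exists_isTrajectory_ending_at (hF : AssumptionF F) {y v : EuclideanSpace ℝ (Fin n)} {τ : ℝ}
    (hρ : 0 ≤ ρ) (hL0 : 0 ≤ L) (hM : ∀ a ∈ Metric.closedBall x ρ, ∀ w ∈ F a, ‖w‖ ≤ M)
    (hL : ∀ a ∈ Metric.closedBall x ρ, ∀ b ∈ Metric.closedBall x ρ,
      F a ⊆ F b + Metric.closedBall 0 (L * ‖b - a‖)) (hv : v ∈ F x) (hτ : 0 ≤ τ)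
    (hLτ : L * τ ≤ 1 / 2) (hyρ : ‖y - x‖ + M * τ ≤ ρ) :
    ∃ w, IsTrajectory F τ w ∧ w τ = y ∧ ‖w 0 - y‖ ≤ M * τ ∧
      ‖w 0 - y + τ • v‖ ≤ 2 * (L * (‖y - x‖ + M * τ)) * τ := by
  -- Time reversal: solve for `-F` from `y` and run the solution backward.
  obtain ⟨f, hf, hfM, hfG, hfv⟩ := exists_continuous_velocity (G := fun a => -F a) (v := -v)
    (fun a => (hF.nonempty a).neg) (fun a => (hF.convex a).neg) (fun a => (hF.compact a).neg)
    hρ hL0 (fun a ha b hb w hw => by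
      obtain ⟨q, hq, c, hc, hqc⟩ := hL a ha b hb (show -w ∈ F a from hw)
      refine ⟨-q, by simpa using hq, -c, by simpa using hc, ?_⟩
      have hqc' : q + c = -w := hqc
      change -q + -c = w
      rw [← neg_add, hqc', neg_neg])
    (fun a ha w hw => by simpa using hM a ha (-w) hw) (by simpa using hv) hτ hLτ hyρ
  have hd : ∀ t, HasDerivAt (fun t => y + ∫ s in (0 : ℝ)..t, f s) (f t) t := fun t =>
    (hf.integral_hasStrictDerivAt 0 t).hasDerivAt.const_add y
  have hd' : ∀ t, HasDerivAt (fun t => y + ∫ s in (0 : ℝ)..(τ - t), f s) (-f (τ - t)) t :=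
    fun t => (hd (τ - t)).comp_const_sub τ t
  refine ⟨fun t => y + ∫ s in (0 : ℝ)..(τ - t), f s, .of_ae ?_ ?_, by simp, ?_, ?_⟩
  · refine LipschitzOnWith.absolutelyContinuousOnInterval (K := M.toNNReal) ?_
    refine (convex_uIcc _ _).lipschitzOnWith_of_nnnorm_hasDerivWithin_le
      (fun t _ => (hd' t).hasDerivWithinAt) fun t _ => ?_
    rw [nnnorm_neg, ← NNReal.coe_le_coe, coe_nnnorm]
    exact (hfM _).trans (Real.le_coe_toNNReal M)
  · refine Eventually.of_forall fun t ht => ⟨_, ?_, hd' t⟩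
    exact hfG (τ - t) ⟨by linarith [ht.2], by linarith [ht.1]⟩
  · have h1 := intervalIntegral.norm_integral_le_of_norm_le_const (a := 0) (b := τ)
      fun s _ => hfM s
    simpa [abs_of_nonneg hτ] using h1
  · have h1 := intervalIntegral.norm_integral_le_of_norm_le_const (a := 0) (b := τ)
      fun s _ => hfv s
    rw [intervalIntegral.integral_sub (hf.intervalIntegrable _ _) (by simp)] at h1
    simpa [abs_of_nonneg hτ] using h1

end Local

lemma AssumptionF.exists_local_bounds (hF : AssumptionF F) (x : EuclideanSpace ℝ (Fin n)) :
    ∃ L M : ℝ, 0 < L ∧ 0 < M ∧ (∀ a ∈ Metric.closedBall x 1, ∀ w ∈ F a, ‖w‖ ≤ M) ∧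
      ∀ a ∈ Metric.closedBall x 1, ∀ b ∈ Metric.closedBall x 1,
        F a ⊆ F b + Metric.closedBall 0 (L * ‖b - a‖) := by
  obtain ⟨L, hL0, hL⟩ := hF.locallyLipschitz _ (isCompact_closedBall x 1)
  obtain ⟨γ, hγ0, hγ⟩ := hF.linearGrowth
  refine ⟨L, γ * (1 + (‖x‖ + 1)), hL0, by positivity, fun a ha w hw => ?_, hL⟩
  refine (hγ a w hw).trans ?_
  rw [mem_closedBall_iff_norm] at ha
  have := norm_le_norm_add_norm_sub' a x
  gcongr
  linarith

/-- Locally bounded speed makes crossing a ball disjoint from the closed set `K` take positive time.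
-/
lemma exists_pos_ofReal_le_minTime (hF : AssumptionF F) (hK : IsClosed K)
    {x : EuclideanSpace ℝ (Fin n)} (hx : x ∉ K) :
    ∃ r : ℝ, 0 < r ∧ ENNReal.ofReal r ≤ minTime F K x := by
  obtain ⟨L, M, hL0, hM0, hM, -⟩ := hF.exists_local_bounds x
  obtain ⟨ε, hε, hball⟩ := Metric.isOpen_iff.1 hK.isOpen_compl x hx
  have hr : 0 < min 1 ε / M := by positivity
  refine ⟨min 1 ε / M, hr, ?_⟩
  by_contra hlt
  push Not at hlt
  obtain ⟨T, hT, hTr, -, z, hz, rfl, hzT⟩ := exists_isTrajectory_of_minTime_lt hx hlt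
  have h1 : M * T < min 1 ε := by rwa [lt_div_iff₀' hM0] at hTr
  have h2 := (hz.norm_sub_le hT.le hM0.le hM
    (by simpa using h1.trans_le (min_le_left _ _))).2 T ⟨hT.le, le_rfl⟩
  refine hball (?_ : z T ∈ Metric.ball (z 0) ε) hzT
  rw [mem_ball_iff_norm]
  exact h2.trans_lt (h1.trans_le (min_le_right _ _))

end MinTime

/-! ### Proximal normals and first-order expansions -/

lemma nonpos_of_forall_pos_lt_mul_le_sq {a C δ : ℝ} (hδ : 0 < δ)
    (h : ∀ t, 0 < t → t < δ → t * a ≤ C * t ^ 2) : a ≤ 0 := by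
  by_contra! ha
  set t := min (δ / 2) (a / (2 * (|C| + 1))) with ht
  have ht0 : 0 < t := by positivity
  have h1 := h t ht0 ((min_le_left _ _).trans_lt (by linarith))
  have h2 : t * (2 * (|C| + 1)) ≤ a := by
    rw [← le_div_iff₀ (by positivity)]
    exact min_le_right _ _
  nlinarith [le_abs_self C]

namespace MinTime

/-- Beyond distance `δ`, Cauchy–Schwarz already gives a quadratic bound with constant `‖v‖ / δ`. -/
lemma mem_proximalNormalCone_of_local {H : Type*} [NormedAddCommGroup H] [InnerProductSpace ℝ H]
    {S : Set H} {x v : H} {δ C : ℝ} (hδ : 0 < δ) (hC : 0 ≤ C)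
    (h : ∀ y ∈ S, ‖y - x‖ < δ → inner ℝ v (y - x) ≤ C * ‖y - x‖ ^ 2) :
    v ∈ proximalNormalCone S x := by
  refine ⟨C + ‖v‖ / δ, by positivity, fun y hy => ?_⟩
  rcases lt_or_ge ‖y - x‖ δ with hlt | hge
  · refine (h y hy hlt).trans ?_
    gcongr
    exact le_add_of_nonneg_right (by positivity)
  · refine (real_inner_le_norm _ _).trans ?_
    have h1 : ‖v‖ ≤ ‖v‖ / δ * ‖y - x‖ := by
      rw [div_mul_eq_mul_div, le_div_iff₀ hδ]
      gcongr
    nlinarith [norm_nonneg (y - x), mul_nonneg hC (sq_nonneg ‖y - x‖)]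

variable {n : ℕ} {F : EuclideanSpace ℝ (Fin n) → Set (EuclideanSpace ℝ (Fin n))}
  {K : Set (EuclideanSpace ℝ (Fin n))}

lemma toLp_mem_epiMinTime {y : EuclideanSpace ℝ (Fin n)} {β : ℝ} (hβ : 0 ≤ β) :
    WithLp.toLp 2 (y, β) ∈ epiMinTime F K ↔ minTime F K y ≤ ENNReal.ofReal β := by
  change (minTime F K y : EReal) ≤ (β : EReal) ↔ _
  rw [← EReal.coe_ennreal_le_coe_ennreal_iff, EReal.coe_ennreal_ofReal, max_eq_left hβ]

lemma nonneg_of_mem_epiMinTime {p : WithLp 2 (EuclideanSpace ℝ (Fin n) × ℝ)}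
    (h : p ∈ epiMinTime F K) : 0 ≤ p.snd := by
  have h' : (minTime F K p.fst : EReal) ≤ (p.snd : EReal) := h
  exact_mod_cast (EReal.coe_ennreal_nonneg _).trans h'

lemma inner_toLp_sub (ζ x y : EuclideanSpace ℝ (Fin n)) (α r β : ℝ) :
    inner ℝ (WithLp.toLp 2 (ζ, α)) (WithLp.toLp 2 (y, β) - WithLp.toLp 2 (x, r)) =
      inner ℝ ζ (y - x) + α * (β - r) := by
  simp [WithLp.prod_inner_apply, mul_comm]

lemma norm_toLp_sub_sq (x y : EuclideanSpace ℝ (Fin n)) (r β : ℝ) :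
    ‖WithLp.toLp 2 (y, β) - WithLp.toLp 2 (x, r)‖ ^ 2 = ‖y - x‖ ^ 2 + (β - r) ^ 2 := by
  simp [WithLp.prod_norm_sq_eq_of_L2]

/-! ### Normals to sublevel sets and to the epigraph -/

section

variable {x ζ : EuclideanSpace ℝ (Fin n)} {r : ℝ}

/-- Nearly optimal trajectories issuing from `x`, followed for a short time `t`. -/
lemma exists_forward_point (hF : AssumptionF F) (hx : x ∉ K) (hr0 : 0 < r)
    (hr : minTime F K x = ENNReal.ofReal r) (ζ : EuclideanSpace ℝ (Fin n)) :
    ∃ δ C₁ C₂ : ℝ, 0 < δ ∧ 0 ≤ C₁ ∧ 0 ≤ C₂ ∧ ∀ t, 0 < t → t < δ → ∀ ε, 0 < ε → ∃ y, ∃ β, 0 ≤ β ∧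
      r - t ≤ β ∧ β ≤ r - t + ε ∧ minTime F K y ≤ ENNReal.ofReal β ∧ ‖y - x‖ ≤ C₁ * t ∧
      t * minHamiltonian F x ζ - C₂ * t ^ 2 ≤ inner ℝ ζ (y - x) := by
  obtain ⟨L, M, hL0, hM0, hM, hL⟩ := hF.exists_local_bounds x
  -- `t < r` ensures the target is not reached before time `t`; `t < 1 / M` keeps the trajectory in
  -- the unit ball around `x`.
  refine ⟨min r (1 / M), M, ‖ζ‖ * (L * M), by positivity, hM0.le, by positivity,
    fun t ht htδ ε hε => ?_⟩
  have htr : t < r := htδ.trans_le (min_le_left _ _)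
  have htM : M * t < 1 := by
    have := htδ.trans_le (min_le_right _ _)
    rwa [lt_div_iff₀' hM0] at this
  obtain ⟨T, hT, hTr, hxT, z, hz, rfl, hzT⟩ := exists_isTrajectory_of_minTime_lt (b := r + ε) hx
    (by rw [hr, ENNReal.ofReal_lt_ofReal_iff (by linarith)]; linarith)
  rw [hr, ENNReal.ofReal_le_ofReal_iff hT.le] at hxT
  have htT : t ≤ T := by linarith
  have hzt := hz.mono ht.le htT
  refine ⟨z t, T - t, by linarith, by linarith, by linarith,
    minTime_isTrajectory_le hz hzT ht.le htT,
    (hzt.norm_sub_le ht.le hM0.le hM (by simpa using htM)).2 t ⟨ht.le, le_rfl⟩, ?_⟩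
  have := hzt.mul_minHamiltonian_le hF ht.le hM0.le hL0.le hM hL (by simpa using htM) ζ
  rw [real_inner_comm]
  simp only [sub_self, norm_zero, zero_add] at this
  linarith

/-- With slack `ε = t`, the forward points stay in the sublevel set, so the proximal inequality
bounds `t * h` by a multiple of `t ^ 2`. -/
lemma minHamiltonian_nonpos (hF : AssumptionF F) (hx : x ∉ K) (hr0 : 0 < r)
    (hr : minTime F K x = ENNReal.ofReal r)
    (hζ : ζ ∈ proximalNormalCone (reachableAt F K (minTime F K x)) x) :
    minHamiltonian F x ζ ≤ 0 := by
  obtain ⟨σ, hσ0, hσ⟩ := hζ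
  obtain ⟨δ, C₁, C₂, hδ, hC₁, hC₂, h⟩ := exists_forward_point hF hx hr0 hr ζ
  refine nonpos_of_forall_pos_lt_mul_le_sq (C := σ * C₁ ^ 2 + C₂) hδ fun t ht htδ => ?_
  obtain ⟨y, β, hβ0, -, hβ, hy, hyx, hyζ⟩ := h t ht htδ t ht
  have h1 := hσ y (show minTime F K y ≤ minTime F K x by
    rw [hr]
    exact hy.trans (ENNReal.ofReal_le_ofReal (by linarith)))
  have h2 := mul_le_mul_of_nonneg_left (pow_le_pow_left₀ (norm_nonneg _) hyx 2) hσ0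
  nlinarith

theorem toLp_minHamiltonian_mem_proximalNormalCone (hF : AssumptionF F) (hx : x ∉ K)
    (hr0 : 0 < r) (hr : minTime F K x = ENNReal.ofReal r)
    (hζ : ζ ∈ proximalNormalCone (reachableAt F K (minTime F K x)) x) :
    WithLp.toLp 2 (ζ, minHamiltonian F x ζ) ∈
      proximalNormalCone (epiMinTime F K) (WithLp.toLp 2 (x, r)) := by
  have hH := minHamiltonian_nonpos hF hx hr0 hr hζ
  obtain ⟨v, hv, hvH⟩ := exists_minHamiltonian_eq hF x ζ
  obtain ⟨L, M, hL0, hM0, hM, hL⟩ := hF.exists_local_bounds x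
  obtain ⟨σ, hσ0, hσ⟩ := hζ
  set H := minHamiltonian F x ζ with hHdef
  have hδ : 0 < min (1 / (2 * L)) (1 / (1 + 2 * M)) := by positivity
  -- The three terms absorb the proximal inequality at the moved point, the variation of `F` along
  -- the motion, and the time slack `d ^ 2`.
  have hC : 0 ≤ σ * (1 + 2 * M) ^ 2 + 2 * ‖ζ‖ * (L * (1 + 2 * M)) - H := by
    have : 0 ≤ σ * (1 + 2 * M) ^ 2 + 2 * ‖ζ‖ * (L * (1 + 2 * M)) := by positivity
    linarith
  refine mem_proximalNormalCone_of_local hδ hC ?_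
  rintro ⟨y, β⟩ hp hpδ
  have hβ0 : 0 ≤ β := nonneg_of_mem_epiMinTime hp
  have hyβ := (toLp_mem_epiMinTime hβ0).1 hp
  rw [inner_toLp_sub]
  set d := ‖WithLp.toLp 2 (y, β) - WithLp.toLp 2 (x, r)‖ with hd
  have hd0 : 0 ≤ d := norm_nonneg _
  have hd2 : d ^ 2 = ‖y - x‖ ^ 2 + (β - r) ^ 2 := norm_toLp_sub_sq x y r β
  have hyd : ‖y - x‖ ≤ d := abs_le_of_sq_le_sq' (by linarith [sq_nonneg (β - r)]) hd0 |>.2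
  have hβd := abs_le_of_sq_le_sq' (show (β - r) ^ 2 ≤ d ^ 2 by linarith [sq_nonneg ‖y - x‖]) hd0
  have hdL : L * d ≤ 1 / 2 := by
    have := (hpδ.trans_le (min_le_left _ _)).le
    rw [le_div_iff₀ (by positivity)] at this
    linarith
  have hdM : d * (1 + 2 * M) < 1 := by
    have := hpδ.trans_le (min_le_right _ _)
    rwa [lt_div_iff₀ (by positivity)] at this
  have hdM' : 0 ≤ M * d := by positivity
  have hMsq : (1 + M) ^ 2 ≤ (1 + 2 * M) ^ 2 := by gcongr; linarith
  have hζ0 := norm_nonneg ζ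
  rcases le_or_gt β r with hβr | hβr
  -- Spare time `r - β`: move backward from `y`, with mean velocity close to the minimizer `v`.
  · have hτ : 0 ≤ r - β := by linarith
    have hτd : M * (r - β) ≤ M * d := mul_le_mul_of_nonneg_left (by linarith) hM0.le
    have hLτ : L * (r - β) ≤ L * d := mul_le_mul_of_nonneg_left (by linarith) hL0.le
    obtain ⟨w, hw, rfl, hw1, hw2⟩ := exists_isTrajectory_ending_at hF (y := y) zero_le_one hL0.le
      hM hL hv hτ (hLτ.trans hdL) (by linarith)
    have h1 := hσ (w 0) (show minTime F K (w 0) ≤ minTime F K x by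
      refine (minTime_le_add hτ hw).trans ?_
      rw [hr]
      refine (add_le_add_right hyβ _).trans ?_
      rw [← ENNReal.ofReal_add hτ hβ0, sub_add_cancel])
    set y := w (r - β)
    have h2 : ‖w 0 - x‖ ≤ (1 + M) * d := by
      have := norm_add_le (w 0 - y) (y - x)
      rw [sub_add_sub_cancel] at this
      linarith
    have h3 := mul_le_mul_of_nonneg_left (pow_le_pow_left₀ (norm_nonneg _) h2 2) hσ0
    have h4 : w 0 - x = (y - x) - (r - β) • v + (w 0 - y + (r - β) • v) := by abel
    have h5 : inner ℝ ζ (w 0 - x) = inner ℝ ζ (y - x) - (r - β) * H +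
        inner ℝ ζ (w 0 - y + (r - β) • v) := by
      conv_lhs => rw [h4, inner_add_right, inner_sub_right, inner_smul_right]
      rw [real_inner_comm v ζ, hvH]
    have h6 : ‖w 0 - y + (r - β) • v‖ ≤ 2 * (L * ((1 + 2 * M) * d)) * d := by
      refine hw2.trans ?_
      have : ‖y - x‖ + M * (r - β) ≤ (1 + 2 * M) * d := by linarith
      gcongr
      linarith
    have h7 := abs_le.1 (abs_real_inner_le_norm ζ (w 0 - y + (r - β) • v))
    have h8 := mul_le_mul_of_nonneg_left h6 hζ0
    have h9 := mul_le_mul_of_nonneg_left hMsq hσ0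
    have h10 := mul_le_mul_of_nonneg_right h9 (sq_nonneg d)
    have h11 := mul_nonneg (neg_nonneg.2 hH) (sq_nonneg d)
    linarith
  · by_cases hyK : y ∈ K
    · have h1 := hσ y (show minTime F K y ≤ _ by simp [minTime_of_mem hyK])
      have h2 : σ * ‖y - x‖ ^ 2 ≤ σ * d ^ 2 := by gcongr
      have h3 : σ * 1 ≤ σ * (1 + 2 * M) ^ 2 := by
        gcongr
        exact one_le_pow₀ (by linarith)
      have h4 : 0 ≤ 2 * ‖ζ‖ * (L * (1 + 2 * M)) := by positivity
      have h5 := mul_le_mul_of_nonneg_right h3 (sq_nonneg d)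
      have h6 := mul_nonneg h4 (sq_nonneg d)
      have h7 := mul_nonneg (neg_nonneg.2 hH) (sq_nonneg d)
      have h8 := mul_nonneg (neg_nonneg.2 hH) (sub_nonneg.2 hβr.le)
      linarith
    · have hdpos : 0 < d := by linarith
      have hd1 : d ≤ 1 := by linarith
      have hdd : d ^ 2 ≤ d := pow_le_of_le_one hd0 hd1 two_ne_zero
      -- Move forward from `y`. The slack `d ^ 2` replaces an optimal trajectory, and the minimum
      -- with `T` below stops at the target if it is reached first.
      obtain ⟨T, hT, hTβ, -, z, hz, rfl, hzT⟩ := exists_isTrajectory_of_minTime_lt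
        (b := β + d ^ 2) hyK (hyβ.trans_lt (by
          rw [ENNReal.ofReal_lt_ofReal_iff (by positivity)]
          have : 0 < d ^ 2 := by positivity
          linarith))
      set t := min (β - r + d ^ 2) T with ht
      have ht0 : 0 ≤ t := le_min (by linarith [sq_nonneg d]) hT.le
      have htT : t ≤ T := min_le_right _ _
      have htτ : t ≤ β - r + d ^ 2 := min_le_left _ _
      have htd : t ≤ 2 * d := by linarith
      have hMt : M * t ≤ M * (2 * d) := mul_le_mul_of_nonneg_left htd hM0.le
      have hzt := hz.mono ht0 htT
      have hsmall : ‖z 0 - x‖ + M * t < 1 := by linarith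
      have h1 := hσ (z t) (show minTime F K (z t) ≤ minTime F K x by
        refine (minTime_isTrajectory_le hz hzT ht0 htT).trans ?_
        rw [hr]
        refine ENNReal.ofReal_le_ofReal ?_
        rcases min_choice (β - r + d ^ 2) T with h | h <;> rw [← ht] at h <;> linarith)
      have h2 := (hzt.norm_sub_le ht0 hM0.le hM hsmall).2 t ⟨ht0, le_rfl⟩
      have h3 := hzt.mul_minHamiltonian_le hF ht0 hM0.le hL0.le hM hL hsmall ζ
      rw [← hHdef, real_inner_comm] at h3
      have h4 : ‖z t - x‖ ≤ (1 + 2 * M) * d := by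
        have := norm_add_le (z t - z 0) (z 0 - x)
        rw [sub_add_sub_cancel] at this
        linarith
      have h5 := mul_le_mul_of_nonneg_left (pow_le_pow_left₀ (norm_nonneg _) h4 2) hσ0
      have h6 : inner ℝ ζ (z t - x) = inner ℝ ζ (z t - z 0) + inner ℝ ζ (z 0 - x) := by
        rw [← inner_add_right, sub_add_sub_cancel]
      have h7 : t * (‖ζ‖ * (L * (‖z 0 - x‖ + M * t))) ≤
          2 * d * (‖ζ‖ * (L * ((1 + 2 * M) * d))) := by
        have : ‖z 0 - x‖ + M * t ≤ (1 + 2 * M) * d := by linarith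
        gcongr
      have h8 : (β - r + d ^ 2) * H ≤ t * H := mul_le_mul_of_nonpos_right htτ hH
      linarith

theorem minHamiltonian_eq_of_mem_proximalNormalCone (hF : AssumptionF F) (hx : x ∉ K)
    (hr0 : 0 < r) (hr : minTime F K x = ENNReal.ofReal r) {α : ℝ}
    (h : WithLp.toLp 2 (ζ, α) ∈ proximalNormalCone (epiMinTime F K) (WithLp.toLp 2 (x, r))) :
    α ≤ 0 ∧ ζ ∈ proximalNormalCone (reachableAt F K (minTime F K x)) x ∧
      minHamiltonian F x ζ = α := by
  obtain ⟨σ, hσ0, hσ⟩ := h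
  have key : ∀ y β, 0 ≤ β → minTime F K y ≤ ENNReal.ofReal β →
      inner ℝ ζ (y - x) + α * (β - r) ≤ σ * (‖y - x‖ ^ 2 + (β - r) ^ 2) := by
    intro y β hβ hy
    have := hσ _ ((toLp_mem_epiMinTime hβ).2 hy)
    rwa [inner_toLp_sub, norm_toLp_sub_sq] at this
  have hα : α ≤ 0 := by
    refine nonpos_of_forall_pos_lt_mul_le_sq (C := σ) one_pos fun t ht _ => ?_
    have := key x (r + t) (by positivity) (by
      rw [hr]
      exact ENNReal.ofReal_le_ofReal (by linarith))
    simp only [sub_self, inner_zero_right, norm_zero, add_sub_cancel_left] at this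
    linarith
  refine ⟨hα, ⟨σ, hσ0, fun y hy => ?_⟩, le_antisymm ?_ ?_⟩
  · have hy' : minTime F K y ≤ ENNReal.ofReal r := hr ▸ hy
    simpa using key y r hr0.le hy'
  -- Forward points with slack `t ^ 2` give `t * (h - α) ≤ C * t ^ 2`.
  · obtain ⟨δ, C₁, C₂, hδ, hC₁, hC₂, hfw⟩ := exists_forward_point hF hx hr0 hr ζ
    refine sub_nonpos.1 (nonpos_of_forall_pos_lt_mul_le_sq
      (C := σ * (C₁ ^ 2 + 1) + C₂ - α) (lt_min hδ one_pos) fun t ht htδ => ?_)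
    obtain ⟨y, β, hβ0, hβ1, hβ2, hy, hyx, hyζ⟩ := hfw t ht (htδ.trans_le (min_le_left _ _))
      (t ^ 2) (by positivity)
    have ht1 : t < 1 := htδ.trans_le (min_le_right _ _)
    have h1 := key y β hβ0 hy
    have h2 : α * (-t + t ^ 2) ≤ α * (β - r) := mul_le_mul_of_nonpos_left (by linarith) hα
    have h3 : (β - r) ^ 2 ≤ t ^ 2 := by
      apply sq_le_sq'
      · linarith
      · nlinarith
    have h4 := pow_le_pow_left₀ (norm_nonneg _) hyx 2
    have h5 := mul_le_mul_of_nonneg_left (add_le_add h4 h3) hσ0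
    linarith
  -- A trajectory arriving at `x` with mean velocity near `v` starts at a point of minimum time at
  -- most `r + t`, giving `t * (α - h) ≤ C * t ^ 2`.
  · obtain ⟨v, hv, hvH⟩ := exists_minHamiltonian_eq hF x ζ
    obtain ⟨L, M, hL0, hM0, hM, hL⟩ := hF.exists_local_bounds x
    refine sub_nonpos.1 (nonpos_of_forall_pos_lt_mul_le_sq
      (C := σ * (M ^ 2 + 1) + ‖ζ‖ * (2 * (L * M)))
      (δ := min (1 / (2 * L)) (1 / M)) (by positivity) fun t ht htδ => ?_)
    have htL : L * t ≤ 1 / 2 := by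
      have := (htδ.trans_le (min_le_left _ _)).le
      rw [le_div_iff₀ (by positivity)] at this
      linarith
    have htM : M * t ≤ 1 := by
      have := (htδ.trans_le (min_le_right _ _)).le
      rwa [le_div_iff₀' hM0] at this
    obtain ⟨w, hw, rfl, hw1, hw2⟩ := exists_isTrajectory_ending_at hF (y := x) zero_le_one hL0.le
      hM hL hv ht.le htL (by simpa using htM)
    set x := w t
    have h1 := key (w 0) (r + t) (by positivity) (by
      refine (minTime_le_add ht.le hw).trans ?_
      rw [hr, ← ENNReal.ofReal_add ht.le hr0.le, add_comm])
    have h2 : inner ℝ ζ (w 0 - x) = inner ℝ ζ (w 0 - x + t • v) - t * minHamiltonian F x ζ := by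
      rw [inner_add_right, inner_smul_right, real_inner_comm v ζ, hvH]
      ring
    have h3 := abs_le.1 (abs_real_inner_le_norm ζ (w 0 - x + t • v))
    simp only [sub_self, norm_zero, zero_add] at hw2
    have h4 := mul_le_mul_of_nonneg_left hw2 (norm_nonneg ζ)
    have h5 := mul_le_mul_of_nonneg_left (pow_le_pow_left₀ (norm_nonneg _) hw1 2) hσ0
    rw [add_sub_cancel_left] at h1
    linarith

end

end MinTime

theorem mainTheorem3 (n : ℕ)
    (F : EuclideanSpace ℝ (Fin n) → Set (EuclideanSpace ℝ (Fin n)))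
    (hF : MinTime.AssumptionF F)
    (K : Set (EuclideanSpace ℝ (Fin n))) (hK : IsClosed K)
    (x : EuclideanSpace ℝ (Fin n)) (hx : x ∈ MinTime.reachableSet F K \ K) :
    (∀ ζ : EuclideanSpace ℝ (Fin n),
      ζ ∈ MinTime.proximalNormalCone (MinTime.reachableAt F K (MinTime.minTime F K x)) x →
        WithLp.toLp 2 (ζ, MinTime.minHamiltonian F x ζ) ∈
          MinTime.proximalNormalCone (MinTime.epiMinTime F K)
            (WithLp.toLp 2 (x, (MinTime.minTime F K x).toReal))) ∧
    (∀ (ζ : EuclideanSpace ℝ (Fin n)) (α : ℝ),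
      WithLp.toLp 2 (ζ, α) ∈
          MinTime.proximalNormalCone (MinTime.epiMinTime F K)
            (WithLp.toLp 2 (x, (MinTime.minTime F K x).toReal)) →
        α ≤ 0 ∧
        ζ ∈ MinTime.proximalNormalCone (MinTime.reachableAt F K (MinTime.minTime F K x)) x ∧
        MinTime.minHamiltonian F x ζ = α) := by
  have hfin : MinTime.minTime F K x ≠ ∞ := (show MinTime.minTime F K x < ∞ from hx.1).ne
  have hr := (ENNReal.ofReal_toReal hfin).symm
  obtain ⟨r₀, hr₀, hle⟩ := MinTime.exists_pos_ofReal_le_minTime hF hK hx.2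
  have hr0 : 0 < (MinTime.minTime F K x).toReal :=
    hr₀.trans_le ((ENNReal.ofReal_le_iff_le_toReal hfin).1 hle)
  exact ⟨fun ζ hζ => MinTime.toLp_minHamiltonian_mem_proximalNormalCone hF hx.2 hr0 hr hζ,
    fun ζ α h => MinTime.minHamiltonian_eq_of_mem_proximalNormalCone hF hx.2 hr0 hr h⟩
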